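/- Let $p>q$ be prime numbers. A skew left brace is a set $A$ with two group structures $(A,\cdot)$ and $(A,\circ)$ such that $a\circ(b\cdot c)=(a\circ b)\cdot a^{-1}\cdot(a\circ c)$ for all $a,b,c\in A$, where $a^{-1}$ is the inverse of $a$ in $(A,\cdot)$. Its lambda map is the homomorphism $\lambda:(A,\circ)\to\operatorname{Aut}(A,\cdot)$, $\lambda_a(b)=a^{-1}\cdot(a\circ b)$, and $\Lambda_A=(A,\cdot)\rtimes_\lambda(A,\circ)$ is the associated semidirect product, with multiplication $(h_1,g_1)(h_2,g_2)=(h_1\cdot\lambda_{g_1}(h_2),\,g_1\circ g_2)$. (a) If $p\not\equiv 1 \pmod q$, then $\Lambda_A\cong\mathbb{Z}_{pq}\times\mathbb{Z}_{pq}$ for every skew left brace $A$ of size $pq$. (b) If $p\equiv 1\pmod q$, let $g$ be any element of multiplicative order $q$ in $\mathbb{Z}_p$. Then for every skew left brace $A$ of size $pq$ the group $\Lambda_A$ is isomorphic to one of the four groups 1. $\mathbb{Z}_{pq}\times\mathbb{Z}_{pq}$, 2. $(\mathbb{Z}_p\times\mathbb{Z}_p)\rtimes_\theta(\mathbb{Z}_q\times\mathbb{Z}_q)$,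 where $\theta_{(x,y)}(a,b)=(g^y a,\,g^y b)$, 3. $(\mathbb{Z}_p\times\mathbb{Z}_p)\rtimes_\psi(\mathbb{Z}_q\times\mathbb{Z}_q)$, where $\psi_{(x,y)}(a,b)=(g^x a,\,g^y b)$, 4. $(\mathbb{Z}_p\times\mathbb{Z}_p)\rtimes_\eta(\mathbb{Z}_q\times\mathbb{Z}_q)$, where $\eta_{(x,y)}(a,b)=(g^{x+y}a,\,b)$, and these four groups are pairwise non-isomorphic. -/

import Mathlib

/-- A skew left brace: a set `A` with two group structures, the additive group `(A, ·)`
(the inherited structure, written `*`) and the multiplicative group `(A, ∘)` (the operation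
`circ`, with its own identity and inverse), such that
`a ∘ (b · c) = (a ∘ b) · a⁻¹ · (a ∘ c)`, where `a⁻¹` is the inverse in `(A, ·)`. -/
class SkewLeftBrace (A : Type*) extends Group A where
  circ : A → A → A
  circOne : A
  circInv : A → A
  circ_assoc : ∀ a b c : A, circ (circ a b) c = circ a (circ b c)
  circOne_circ : ∀ a : A, circ circOne a = a
  circInv_circ : ∀ a : A, circ (circInv a) a = circOne
  circ_mul : ∀ a b c : A, circ a (b * c) = circ a b * a⁻¹ * circ a c

namespace SkewLeftBrace

/-- A copy of the set `A`, carrying the group structure `(A, ∘)`. -/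
@[ext]
structure Circ (A : Type*) where
  val : A

instance (A : Type*) [SkewLeftBrace A] : Mul (Circ A) := ⟨fun a b => ⟨circ a.val b.val⟩⟩

instance (A : Type*) [SkewLeftBrace A] : One (Circ A) := ⟨⟨circOne⟩⟩

instance (A : Type*) [SkewLeftBrace A] : Inv (Circ A) := ⟨fun a => ⟨circInv a.val⟩⟩

instance (A : Type*) [SkewLeftBrace A] : Group (Circ A) :=
  Group.ofLeftAxioms (fun a b c => Circ.ext (circ_assoc a.val b.val c.val))
    (fun a => Circ.ext (circOne_circ a.val)) (fun a => Circ.ext (circInv_circ a.val))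

variable {A : Type*} [SkewLeftBrace A]

theorem circ_circInv (a : A) : circ a (circInv a) = circOne :=
  congrArg Circ.val (mul_inv_cancel (⟨a⟩ : Circ A))

theorem circ_one (a : A) : circ a 1 = a := by
  have h := circ_mul a 1 1
  rw [mul_one, mul_assoc, eq_comm, mul_eq_left, inv_mul_eq_one] at h
  exact h.symm

/-- The two groups have the same identity element. -/
theorem circOne_eq : (circOne : A) = 1 := by
  have h := circOne_circ (1 : A)
  rwa [circ_one] at h

/-- The map `λ_a(b) = a⁻¹ · (a ∘ b)`. -/
def lam (a b : A) : A := a⁻¹ * circ a b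

theorem lam_mul (a b c : A) : lam a (b * c) = lam a b * lam a c := by
  simp only [lam, circ_mul, mul_assoc]

theorem lam_circOne (b : A) : lam circOne b = b := by
  rw [lam, circOne_circ, circOne_eq, inv_one, one_mul]

theorem lam_circ (a b c : A) : lam (circ a b) c = lam a (lam b c) := by
  have h1 : lam a (b⁻¹) = (lam a b)⁻¹ :=
    map_inv (MonoidHom.mk' (lam a) (lam_mul a)) b
  have h2 : lam a (lam b c) = lam a (b⁻¹) * lam a (circ b c) := lam_mul a _ _
  rw [h2, h1]
  simp only [lam, circ_assoc, mul_inv_rev, inv_inv, mul_assoc, mul_inv_cancel_left]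

variable (A) in
/-- The lambda map `λ : (A, ∘) → Aut (A, ·)`, `λ_a(b) = a⁻¹ · (a ∘ b)`. -/
def lambdaHom : Circ A →* MulAut A where
  toFun a :=
    { toFun := fun b => lam a.val b
      invFun := fun b => lam (circInv a.val) b
      left_inv := fun b => by
        change lam (circInv a.val) (lam a.val b) = b
        rw [← lam_circ, circInv_circ, lam_circOne]
      right_inv := fun b => by
        change lam a.val (lam (circInv a.val) b) = b
        rw [← lam_circ, circ_circInv, lam_circOne]
      map_mul' := fun b c => lam_mul a.val b c }
  map_one' := MulEquiv.ext fun b => lam_circOne b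
  map_mul' a b := MulEquiv.ext fun c => lam_circ a.val b.val c

variable (A) in
/-- The group `Λ_A = (A, ·) ⋊_λ (A, ∘)`. -/
abbrev Lambda : Type _ := A ⋊[lambdaHom A] (Circ A)

end SkewLeftBrace

namespace PQGroups

/-- The group `ℤ_n × ℤ_n`, written multiplicatively. -/
abbrev ZSq (n : ℕ) : Type := Multiplicative (ZMod n × ZMod n)

/-- The automorphism `(a, b) ↦ (u a, v b)` of `ℤ_p × ℤ_p`, for units `u`, `v` modulo `p`. -/
def diagAut {p : ℕ} (u v : (ZMod p)ˣ) : MulAut (ZSq p) where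
  toFun n := Multiplicative.ofAdd ((u : ZMod p) * n.toAdd.1, (v : ZMod p) * n.toAdd.2)
  invFun n :=
    Multiplicative.ofAdd (((u⁻¹ : (ZMod p)ˣ) : ZMod p) * n.toAdd.1,
      ((v⁻¹ : (ZMod p)ˣ) : ZMod p) * n.toAdd.2)
  left_inv n := by simp
  right_inv n := by simp
  map_mul' m n := by simp [mul_add, ← ofAdd_add]

theorem diagAut_mul {p : ℕ} (u v u' v' : (ZMod p)ˣ) :
    diagAut (u * u') (v * v') = diagAut u v * diagAut u' v' := by
  ext n <;> simp [diagAut, mul_assoc]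

/-- `g ^ x` for `x ∈ ℤ_q` is multiplicative in `x` when `g` has order `q`. -/
theorem pow_val_add {p q : ℕ} [NeZero q] {g : (ZMod p)ˣ} (hg : orderOf g = q) (x y : ZMod q) :
    g ^ (x + y).val = g ^ x.val * g ^ y.val := by
  rw [ZMod.val_add, ← pow_add]
  have h := pow_mod_orderOf g (x.val + y.val)
  rwa [hg] at h

/-- `θ_{(x,y)}(a,b) = (g^y a, g^y b)`. -/
def theta {p q : ℕ} [NeZero q] (g : (ZMod p)ˣ) (hg : orderOf g = q) :
    ZSq q →* MulAut (ZSq p) :=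
  MonoidHom.mk' (fun k => diagAut (g ^ k.toAdd.2.val) (g ^ k.toAdd.2.val)) fun k l => by
    rw [← diagAut_mul, toAdd_mul, Prod.snd_add, pow_val_add hg]

/-- `ψ_{(x,y)}(a,b) = (g^x a, g^y b)`. -/
def psi {p q : ℕ} [NeZero q] (g : (ZMod p)ˣ) (hg : orderOf g = q) :
    ZSq q →* MulAut (ZSq p) :=
  MonoidHom.mk' (fun k => diagAut (g ^ k.toAdd.1.val) (g ^ k.toAdd.2.val)) fun k l => by
    rw [← diagAut_mul, toAdd_mul, Prod.fst_add, Prod.snd_add, pow_val_add hg, pow_val_add hg]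

/-- `η_{(x,y)}(a,b) = (g^(x+y) a, b)`. -/
def eta {p q : ℕ} [NeZero q] (g : (ZMod p)ˣ) (hg : orderOf g = q) :
    ZSq q →* MulAut (ZSq p) :=
  MonoidHom.mk' (fun k => diagAut (g ^ (k.toAdd.1 + k.toAdd.2).val) 1) fun k l => by
    rw [← diagAut_mul, toAdd_mul, Prod.fst_add, Prod.snd_add, add_add_add_comm, pow_val_add hg,
      one_mul]

end PQGroups

/-! ### Exponents in `ZMod n` and conjugation by powers -/

section Exponents

variable {G : Type*} [Group G] {n : ℕ} {x : G}

/-! The group `Λ_A` has order `(pq)²`. The plan is to find generators `a, b` of order `p` and `s, t`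
of exponent `q`, with `a, b` commuting, `s, t` commuting, and conjugation by `s, t` raising `a` and
`b` to powers; this presents `Λ_A` as a diagonal semidirect product
(`nonempty_mulEquiv_of_generators`).

Take `a` of order `p` in `(A,·)`; it spans a normal subgroup. Each `λ_x` has order dividing `pq`,
which is prime to `q - 1`, so it acts trivially on the quotient of order `q`
(`inv_mul_apply_mem_zpowers`). Hence `a` also has order `p` for `∘` (`orderOf_circ`), and `λ_a`
fixes `a`. Let `t` have order `q` for `∘`. A Sylow `q`-subgroup of `Λ_A` containing `t` is abelian
of order `q²`, too large to embed in `(A,∘)`, so it meets `(A,·)` in some `s ≠ 1` fixed by `λ_t`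
(`exists_fixed_orderOf`).

The remaining generator `b` is the copy of `a` in `(A,∘)`, corrected by a power of `a` so as to
commute with `s`. If `s` and `a` commute, no correction is needed and `t` acts on `a` and `b` by the
same exponent; otherwise commutation with `s` forces `t` to send `b` to a power of itself.

All exponents are `q`-th roots of unity in `ℤ_p`. If `q ∤ p - 1` they equal `1`. Otherwise they are
powers of `g`, and a change of basis in `⟨s, t⟩` leaves four actions. Centres separate the four
groups: everything, nontrivial without `p`-torsion (`θ`), trivial (`ψ`), and noncentral elements
present but nontrivial `p`-torsion in the centre (`η`). -/

theorem pow_zmod_val_add [NeZero n] (hx : x ^ n = 1) (i j : ZMod n) :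
    x ^ (i + j).val = x ^ i.val * x ^ j.val := by
  rw [ZMod.val_add, ← pow_add, ← pow_eq_pow_mod _ hx]

theorem pow_zmod_val_mul (hx : x ^ n = 1) (i j : ZMod n) :
    x ^ (i * j).val = (x ^ i.val) ^ j.val := by
  rw [ZMod.val_mul, ← pow_mul, ← pow_eq_pow_mod _ hx]

theorem pow_natCast_val (hx : x ^ n = 1) (i : ℕ) : x ^ (i : ZMod n).val = x ^ i := by
  rw [ZMod.val_natCast, ← pow_eq_pow_mod _ hx]

/-- Conjugation by `z` sends `x` to `x ^ u`. -/
def ConjPow (z x : G) (u : ZMod n) : Prop := z * x * z⁻¹ = x ^ u.val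

theorem ConjPow.conj_pow {z : G} {u : ZMod n} (h : ConjPow z x u) (i : ℕ) :
    z * x ^ i * z⁻¹ = (x ^ i) ^ u.val := by
  rw [← _root_.conj_pow, h, ← pow_mul, ← pow_mul, mul_comm]

theorem pow_one_val (hx : x ^ n = 1) : x ^ (1 : ZMod n).val = x := by
  simpa using pow_natCast_val hx 1

theorem zmod_eq_of_pow_val_eq [NeZero n] (hx : orderOf x = n) {i j : ZMod n}
    (h : x ^ i.val = x ^ j.val) : i = j := by
  rw [pow_inj_mod, hx, Nat.mod_eq_of_lt (ZMod.val_lt i), Nat.mod_eq_of_lt (ZMod.val_lt j)] at h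
  exact ZMod.val_injective n h

namespace ConjPow

variable {z w : G} {u v : ZMod n}

theorem mul (hx : x ^ n = 1) (h : ConjPow z x u) (h' : ConjPow w x v) :
    ConjPow (z * w) x (u * v) := by
  have : z * w * x * (z * w)⁻¹ = z * (w * x * w⁻¹) * z⁻¹ := by group
  rw [ConjPow, this, h', h.conj_pow, mul_comm u v, pow_zmod_val_mul hx]

theorem of_commute (hx : x ^ n = 1) (h : Commute z x) : ConjPow z x (1 : ZMod n) := by
  rw [ConjPow, h.eq, mul_inv_cancel_right, pow_one_val hx]

theorem commute (hx : x ^ n = 1) (h : ConjPow z x (1 : ZMod n)) : Commute z x := by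
  rw [ConjPow, pow_one_val hx, mul_inv_eq_iff_eq_mul] at h
  exact h

theorem pow (hx : x ^ n = 1) (h : ConjPow z x u) (i : ℕ) : ConjPow (z ^ i) x (u ^ i) := by
  induction i with
  | zero => simpa using of_commute hx (Commute.one_left x)
  | succ i ih => rw [pow_succ, pow_succ]; exact ih.mul hx h

theorem eq_one [NeZero n] (hx : orderOf x = n) (h : ConjPow z x u) (hz : Commute z x) : u = 1 := by
  have hx' : x ^ n = 1 := hx ▸ pow_orderOf_eq_one x
  refine zmod_eq_of_pow_val_eq hx ?_
  rw [pow_one_val hx', ← h, hz.eq, mul_inv_cancel_right]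

theorem pow_eq_one [NeZero n] (hx : orderOf x = n) (h : ConjPow z x u) {i : ℕ} (hz : z ^ i = 1) :
    u ^ i = 1 := by
  have hx' : x ^ n = 1 := hx ▸ pow_orderOf_eq_one x
  exact (h.pow hx' i).eq_one hx (hz ▸ Commute.one_left x)

end ConjPow

theorem exists_conjPow_of_mem [NeZero n] (hx : x ^ n = 1) {z : G}
    (h : z * x * z⁻¹ ∈ Subgroup.zpowers x) : ∃ u : ZMod n, ConjPow z x u := by
  have hfin : IsOfFinOrder x := isOfFinOrder_iff_pow_eq_one.2 ⟨n, NeZero.pos n, hx⟩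
  obtain ⟨k, hk⟩ := hfin.mem_powers_iff_mem_zpowers.2 h
  exact ⟨k, by rw [ConjPow, pow_natCast_val hx]; exact hk.symm⟩

end Exponents

/-- In `ℤ_ℓ` with `ℓ` prime, the only root of unity of order prime to `ℓ - 1` is `1`. -/
theorem zmod_eq_one_of_pow_eq_one {l n : ℕ} [Fact l.Prime] (hn : Nat.Coprime n (l - 1))
    (hn0 : n ≠ 0) {u : ZMod l} (hu : u ^ n = 1) : u = 1 := by
  have hu0 : u ≠ 0 := by
    rintro rfl
    simp [hn0] at hu
  have h := pow_gcd_eq_one.2 ⟨hu, ZMod.pow_card_sub_one_eq_one hu0⟩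
  rwa [hn.gcd_eq_one, pow_one] at h

/-! ### Recognizing diagonal semidirect products -/

namespace PQGroups

section Recognition

variable {G : Type*} [Group G]

/-- The homomorphism `(i, j) ↦ x ^ i * y ^ j` on `ℤ_n × ℤ_n`. -/
def zsqHom {n : ℕ} [NeZero n] (x y : G) (hx : x ^ n = 1) (hy : y ^ n = 1) (hxy : Commute x y) :
    ZSq n →* G :=
  MonoidHom.mk' (fun k => x ^ k.toAdd.1.val * y ^ k.toAdd.2.val) fun k l => by
    rw [toAdd_mul, Prod.fst_add, Prod.snd_add, pow_zmod_val_add hx, pow_zmod_val_add hy]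
    exact ((hxy.pow_pow _ _).symm.mul_mul_mul_comm _ _).symm

theorem zsqHom_ofAdd {n : ℕ} [NeZero n] {x y : G} (hx : x ^ n = 1) (hy : y ^ n = 1)
    (hxy : Commute x y) (i j : ZMod n) :
    zsqHom x y hx hy hxy (Multiplicative.ofAdd (i, j)) = x ^ i.val * y ^ j.val := rfl

theorem zsq_eq_pow_mul_pow {n : ℕ} [NeZero n] (k : ZSq n) :
    k = Multiplicative.ofAdd ((1, 0) : ZMod n × ZMod n) ^ k.toAdd.1.val *
      Multiplicative.ofAdd ((0, 1) : ZMod n × ZMod n) ^ k.toAdd.2.val := by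
  apply Multiplicative.toAdd.injective
  ext <;> simp

/-- A finite group of order `(pq)²` with generators satisfying the defining relations of a
semidirect product `(ℤ_p × ℤ_p) ⋊ (ℤ_q × ℤ_q)` with diagonal action is that product. -/
theorem nonempty_mulEquiv_of_generators {p q : ℕ} [NeZero p] [NeZero q]
    (hG : Nat.card G = (p * q) ^ 2) {a b s t : G} (ha : a ^ p = 1) (hb : b ^ p = 1)
    (hs : s ^ q = 1) (ht : t ^ q = 1) (hab : Commute a b) (hst : Commute s t)
    (hgen : Subgroup.closure {a, b, s, t} = ⊤) {u₁ v₁ u₂ v₂ : (ZMod p)ˣ}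
    (hsa : ConjPow s a (u₁ : ZMod p)) (hsb : ConjPow s b (v₁ : ZMod p))
    (hta : ConjPow t a (u₂ : ZMod p)) (htb : ConjPow t b (v₂ : ZMod p))
    (φ : ZSq q →* MulAut (ZSq p))
    (h₁ : φ (Multiplicative.ofAdd (1, 0)) = diagAut u₁ v₁)
    (h₂ : φ (Multiplicative.ofAdd (0, 1)) = diagAut u₂ v₂) :
    Nonempty (G ≃* ZSq p ⋊[φ] ZSq q) := by
  set f := zsqHom a b ha hb hab with hf
  set h := zsqHom s t hs ht hst with hh
  have key : ∀ (z : G) (u v : (ZMod p)ˣ), ConjPow z a (u : ZMod p) → ConjPow z b (v : ZMod p) →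
      ∀ n, f (diagAut u v n) = MulAut.conj z (f n) := by
    intro z u v hza hzb n
    have e1 : f (diagAut u v n) = a ^ ((u : ZMod p) * n.toAdd.1).val *
      b ^ ((v : ZMod p) * n.toAdd.2).val := rfl
    have e2 : f n = a ^ n.toAdd.1.val * b ^ n.toAdd.2.val := rfl
    rw [e1, e2, map_mul, MulAut.conj_apply, MulAut.conj_apply, hza.conj_pow, hzb.conj_pow,
      mul_comm (u : ZMod p), mul_comm (v : ZMod p), pow_zmod_val_mul ha, pow_zmod_val_mul hb]
  have hp1 : ∀ (k l : ZSq q), (∀ n, f (φ k n) = MulAut.conj (h k) (f n)) →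
      (∀ n, f (φ l n) = MulAut.conj (h l) (f n)) →
      ∀ n, f (φ (k * l) n) = MulAut.conj (h (k * l)) (f n) := by
    intro k l hk hl n
    rw [map_mul, MulAut.mul_apply, hk, hl, map_mul, map_mul, MulAut.mul_apply]
  have hp2 : ∀ (k : ZSq q), (∀ n, f (φ k n) = MulAut.conj (h k) (f n)) → ∀ i : ℕ,
      ∀ n, f (φ (k ^ i) n) = MulAut.conj (h (k ^ i)) (f n) := by
    intro k hk i
    induction i with
    | zero => intro n; simp
    | succ i ih => rw [pow_succ]; exact hp1 _ _ ih hk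
  have hs1 : h (Multiplicative.ofAdd (1, 0)) = s := by
    rw [hh, zsqHom_ofAdd, ZMod.val_zero, pow_zero, mul_one, pow_one_val hs]
  have ht1 : h (Multiplicative.ofAdd (0, 1)) = t := by
    rw [hh, zsqHom_ofAdd, ZMod.val_zero, pow_zero, one_mul, pow_one_val ht]
  have ha1 : f (Multiplicative.ofAdd (1, 0)) = a := by
    rw [hf, zsqHom_ofAdd, ZMod.val_zero, pow_zero, mul_one, pow_one_val ha]
  have hb1 : f (Multiplicative.ofAdd (0, 1)) = b := by
    rw [hf, zsqHom_ofAdd, ZMod.val_zero, pow_zero, one_mul, pow_one_val hb]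
  -- Compatibility with the action is multiplicative in `k`, so it need only be checked at `(1,0)`
  -- and `(0,1)`, where it is the conjugation relations for `s` and `t`.
  have hcomp : ∀ k, f.comp (φ k).toMonoidHom = (MulAut.conj (h k)).toMonoidHom.comp f := by
    intro k
    refine MonoidHom.ext fun n => ?_
    change f (φ k n) = MulAut.conj (h k) (f n)
    rw [zsq_eq_pow_mul_pow k]
    refine hp1 _ _ (hp2 _ ?_ _) (hp2 _ ?_ _) n
    · rw [h₁, hs1]; exact key s u₁ v₁ hsa hsb
    · rw [h₂, ht1]; exact key t u₂ v₂ hta htb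
  let F := SemidirectProduct.lift f h hcomp
  have hsurj : Function.Surjective F := by
    rw [← MonoidHom.range_eq_top, eq_top_iff, ← hgen, Subgroup.closure_le]
    rintro x (rfl | rfl | rfl | rfl)
    · exact ⟨SemidirectProduct.inl _, (SemidirectProduct.lift_inl ..).trans ha1⟩
    · exact ⟨SemidirectProduct.inl _, (SemidirectProduct.lift_inl ..).trans hb1⟩
    · exact ⟨SemidirectProduct.inr _, (SemidirectProduct.lift_inr ..).trans hs1⟩
    · exact ⟨SemidirectProduct.inr _, (SemidirectProduct.lift_inr ..).trans ht1⟩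
  have hcard : Nat.card (ZSq p ⋊[φ] ZSq q) = (p * q) ^ 2 := by
    rw [SemidirectProduct.card]
    simp only [Nat.card_congr Multiplicative.toAdd, Nat.card_prod, Nat.card_zmod]
    ring
  have hfin : Finite (ZSq p ⋊[φ] ZSq q) :=
    Nat.finite_of_card_ne_zero (hcard ▸ pow_ne_zero _ (NeZero.ne _))
  have hbij : Function.Bijective F :=
    (Nat.bijective_iff_surjective_and_card F).2 ⟨hsurj, hcard.trans hG.symm⟩
  exact ⟨(MulEquiv.ofBijective F hbij).symm⟩

theorem nonempty_semidirectProduct_one_mulEquiv_zsq {p q : ℕ} (hpq : Nat.Coprime p q) :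
    Nonempty (ZSq p ⋊[(1 : ZSq q →* MulAut (ZSq p))] ZSq q ≃* ZSq (p * q)) := by
  let e : (ZMod p × ZMod p) × (ZMod q × ZMod q) ≃+ ZMod (p * q) × ZMod (p * q) :=
    (AddEquiv.prodProdProdComm _ _ _ _).trans
      (((ZMod.chineseRemainder hpq).symm.toAddEquiv).prodCongr
        ((ZMod.chineseRemainder hpq).symm.toAddEquiv))
  exact ⟨(SemidirectProduct.mulEquivProd.trans (MulEquiv.prodMultiplicative _ _).symm).trans
    e.toMultiplicative⟩

end Recognition

/-! ### Normalizing the exponents -/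

section Classification

variable {G : Type*} [Group G] {p q : ℕ}

/-- Generators `a, b` of order `p` and `s, t` of order `q` with the relations satisfied in the
semidirect product attached to a skew brace of size `pq`. -/
structure IsGenerating (p q : ℕ) (a b s t : G) (u₁ u₂ v : ZMod p) : Prop where
  orderOf_a : orderOf a = p
  orderOf_b : orderOf b = p
  s_pow : s ^ q = 1
  t_pow : t ^ q = 1
  commute_ab : Commute a b
  commute_st : Commute s t
  commute_sb : Commute s b
  conj_sa : ConjPow s a u₁
  conj_ta : ConjPow t a u₂
  conj_tb : ConjPow t b v
  eq_of_eq_one : u₁ = 1 → u₂ = v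
  closure_eq : Subgroup.closure {a, b, s, t} = ⊤

theorem closure_eq_top_of_mem {a b s t s' t' : G} (h : Subgroup.closure {a, b, s, t} = ⊤)
    (hs : s ∈ Subgroup.closure {a, b, s', t'}) (ht : t ∈ Subgroup.closure {a, b, s', t'}) :
    Subgroup.closure {a, b, s', t'} = ⊤ := by
  rw [eq_top_iff, ← h, Subgroup.closure_le]
  rintro x (rfl | rfl | rfl | rfl)
  · exact Subgroup.subset_closure (by simp)
  · exact Subgroup.subset_closure (by simp)
  · exact hs
  · exact ht

namespace IsGenerating

variable {a b s t : G} {u₁ u₂ v : ZMod p}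

theorem a_pow (h : IsGenerating p q a b s t u₁ u₂ v) : a ^ p = 1 := by
  simpa [h.orderOf_a] using pow_orderOf_eq_one a

theorem b_pow (h : IsGenerating p q a b s t u₁ u₂ v) : b ^ p = 1 := by
  simpa [h.orderOf_b] using pow_orderOf_eq_one b

theorem nonempty_mulEquiv_of_eq_one [NeZero p] [NeZero q] (hG : Nat.card G = (p * q) ^ 2)
    (hpq : Nat.Coprime p q) (h : IsGenerating p q a b s t (1 : ZMod p) 1 1) :
    Nonempty (G ≃* ZSq (p * q)) := by
  have e1 : diagAut (1 : (ZMod p)ˣ) 1 = 1 := by ext n <;> simp [diagAut]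
  obtain ⟨e⟩ := nonempty_mulEquiv_of_generators (u₁ := 1) (v₁ := 1) (u₂ := 1) (v₂ := 1) hG
    h.a_pow h.b_pow h.s_pow h.t_pow h.commute_ab h.commute_st h.closure_eq
    (by simpa using h.conj_sa) (by simpa using ConjPow.of_commute h.b_pow h.commute_sb)
    (by simpa using h.conj_ta) (by simpa using h.conj_tb) 1 e1.symm e1.symm
  obtain ⟨e'⟩ := nonempty_semidirectProduct_one_mulEquiv_zsq hpq
  exact ⟨e.trans e'⟩

end IsGenerating

theorem units_pow_eq_one {g : (ZMod p)ˣ} (hg : orderOf g = q) : g ^ q = 1 :=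
  hg ▸ pow_orderOf_eq_one g

theorem exists_eq_units_pow_val [Fact p.Prime] [NeZero q] {g : (ZMod p)ˣ} (hg : orderOf g = q)
    {u : ZMod p} (hu : u ^ q = 1) : ∃ i : ZMod q, u = ((g ^ i.val : (ZMod p)ˣ) : ZMod p) := by
  have hprim : IsPrimitiveRoot (g : ZMod p) q := by
    rw [IsPrimitiveRoot.coe_units_iff, ← hg]
    exact IsPrimitiveRoot.orderOf g
  obtain ⟨i, -, hi⟩ := hprim.eq_pow_of_pow_eq_one hu
  exact ⟨i, by rw [pow_natCast_val (units_pow_eq_one hg), ← hi, Units.val_pow_eq_pow_val]⟩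

theorem conjPow_pow_val [NeZero p] {g : (ZMod p)ˣ} (hg : orderOf g = q) {z x : G} (hx : x ^ p = 1)
    {i : ZMod q} (h : ConjPow z x ((g ^ i.val : (ZMod p)ˣ) : ZMod p)) (m : ZMod q) :
    ConjPow (z ^ m.val) x ((g ^ (i * m).val : (ZMod p)ˣ) : ZMod p) := by
  rw [pow_zmod_val_mul (units_pow_eq_one hg), Units.val_pow_eq_pow_val]
  exact h.pow hx _

theorem conjPow_mul_val [NeZero p] [NeZero q] {g : (ZMod p)ˣ} (hg : orderOf g = q) {z w x : G}
    (hx : x ^ p = 1) {i j : ZMod q} (h : ConjPow z x ((g ^ i.val : (ZMod p)ˣ) : ZMod p))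
    (h' : ConjPow w x ((g ^ j.val : (ZMod p)ˣ) : ZMod p)) :
    ConjPow (z * w) x ((g ^ (i + j).val : (ZMod p)ˣ) : ZMod p) := by
  rw [pow_zmod_val_add (units_pow_eq_one hg), Units.val_mul]
  exact h.mul hx h'

/-- Writing exponents as powers of `g`, `s` acts on `(a, b)` with weights `(i, 0)` and `t` with
weights `(k, j)` over the field `ZMod q`. Row operations give the four cases; for `i = 0`, the field
`eq_of_eq_one` supplies `k = j`. -/
theorem IsGenerating.nonempty_mulEquiv [Fact p.Prime] [Fact q.Prime]
    (hG : Nat.card G = (p * q) ^ 2) (hpq : Nat.Coprime p q) {a b s t : G} {u₁ u₂ v : ZMod p}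
    (h : IsGenerating p q a b s t u₁ u₂ v) (g : (ZMod p)ˣ) (hg : orderOf g = q) :
    Nonempty (G ≃* ZSq (p * q)) ∨ Nonempty (G ≃* ZSq p ⋊[theta g hg] ZSq q) ∨
      Nonempty (G ≃* ZSq p ⋊[psi g hg] ZSq q) ∨ Nonempty (G ≃* ZSq p ⋊[eta g hg] ZSq q) := by
  have hs := h.s_pow
  have ht := h.t_pow
  have ha := h.a_pow
  have hb := h.b_pow
  obtain ⟨i, rfl⟩ := exists_eq_units_pow_val hg (h.conj_sa.pow_eq_one h.orderOf_a hs)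
  obtain ⟨k, rfl⟩ := exists_eq_units_pow_val hg (h.conj_ta.pow_eq_one h.orderOf_a ht)
  obtain ⟨j, rfl⟩ := exists_eq_units_pow_val hg (h.conj_tb.pow_eq_one h.orderOf_b ht)
  have hsa := h.conj_sa
  have hta := h.conj_ta
  have htb := h.conj_tb
  have hsb : ConjPow s b ((g ^ (0 : ZMod q).val : (ZMod p)ˣ) : ZMod p) := by
    simpa using ConjPow.of_commute hb h.commute_sb
  have hinv : ∀ {z : G} {m : ZMod q} {K : Subgroup G}, z ^ q = 1 → m ≠ 0 → z ^ m.val ∈ K →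
      z ∈ K := by
    intro z m K hz hm hK
    have hz' : (z ^ m.val) ^ (m⁻¹).val = z := by
      rw [← pow_zmod_val_mul hz, mul_inv_cancel₀ hm, pow_one_val hz]
    exact hz' ▸ K.pow_mem hK _
  by_cases hi : i = 0
  · subst hi
    have hkj := h.eq_of_eq_one (by simp)
    by_cases hj : j = 0
    · subst hj
      left
      rw [hkj] at h
      simp only [ZMod.val_zero, pow_zero, Units.val_one] at h
      exact h.nonempty_mulEquiv_of_eq_one hG hpq
    · right; left
      have hta' := conjPow_pow_val hg ha (hkj ▸ hta) j⁻¹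
      have htb' := conjPow_pow_val hg hb htb j⁻¹
      rw [mul_inv_cancel₀ hj] at hta' htb'
      refine nonempty_mulEquiv_of_generators hG ha hb hs (t := t ^ (j⁻¹).val)
        (by rw [← pow_mul, mul_comm, pow_mul, ht, one_pow]) h.commute_ab
        (h.commute_st.pow_right _) (closure_eq_top_of_mem h.closure_eq ?_ ?_)
        hsa hsb hta' htb' _ rfl rfl
      · exact Subgroup.subset_closure (by simp)
      · exact hinv ht (inv_ne_zero hj) (Subgroup.subset_closure (by simp))
  · have hsa' := conjPow_pow_val hg ha hsa i⁻¹
    have hsb' := conjPow_pow_val hg hb hsb i⁻¹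
    rw [mul_inv_cancel₀ hi] at hsa'
    rw [zero_mul] at hsb'
    -- Rescaled to have weights `(1, 0)`; then `t ^ m * s' ^ n` has weights `(k m + n, j m)`.
    set s' := s ^ (i⁻¹).val with hs'
    have hs'q : s' ^ q = 1 := by rw [← pow_mul, mul_comm, pow_mul, hs, one_pow]
    have hst' : Commute s' t := h.commute_st.pow_left _
    have hpow : ∀ m n : ZMod q, (t ^ m.val * s' ^ n.val) ^ q = 1 := by
      intro m n
      rw [(hst'.pow_pow _ _).symm.mul_pow, ← pow_mul, ← pow_mul, mul_comm, pow_mul, ht,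
        mul_comm n.val, pow_mul, hs'q, one_pow, one_pow, one_mul]
    have hcl : ∀ m n : ZMod q, m ≠ 0 →
        Subgroup.closure {a, b, s', t ^ m.val * s' ^ n.val} = ⊤ := by
      intro m n hm
      have hmem : s' ∈ Subgroup.closure {a, b, s', t ^ m.val * s' ^ n.val} :=
        Subgroup.subset_closure (by simp)
      refine closure_eq_top_of_mem h.closure_eq ?_ ?_
      · exact hinv hs (inv_ne_zero hi) hmem
      · refine hinv ht hm ?_
        rw [← Subgroup.mul_mem_cancel_right _ (Subgroup.pow_mem _ hmem n.val)]
        exact Subgroup.subset_closure (by simp)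
    have hcom : ∀ m n : ZMod q, Commute s' (t ^ m.val * s' ^ n.val) := fun m n =>
      (hst'.pow_right _).mul_right ((Commute.refl s').pow_right _)
    have hta' : ∀ m n : ZMod q, ConjPow (t ^ m.val * s' ^ n.val) a
        ((g ^ (k * m + 1 * n).val : (ZMod p)ˣ) : ZMod p) := fun m n =>
      conjPow_mul_val hg ha (conjPow_pow_val hg ha hta m) (conjPow_pow_val hg ha hsa' n)
    have htb' : ∀ m n : ZMod q, ConjPow (t ^ m.val * s' ^ n.val) b
        ((g ^ (j * m + 0 * n).val : (ZMod p)ˣ) : ZMod p) := fun m n =>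
      conjPow_mul_val hg hb (conjPow_pow_val hg hb htb m) (conjPow_pow_val hg hb hsb' n)
    right; right
    by_cases hj : j = 0
    · right
      -- With `j = 0`, this `n` makes the second generator have weights `(1, 0)` too, as `eta`
      -- demands.
      have h1 := hta' 1 (1 - k)
      have h2 := htb' 1 (1 - k)
      rw [show k * 1 + 1 * (1 - k) = 0 + (1 : ZMod q) by ring] at h1
      rw [hj, show 0 * 1 + 0 * (1 - k) = (0 : ZMod q) by ring, ZMod.val_zero, pow_zero] at h2
      rw [← add_zero (1 : ZMod q)] at hsa'
      rw [ZMod.val_zero, pow_zero] at hsb'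
      exact nonempty_mulEquiv_of_generators hG ha hb hs'q (hpow _ _) h.commute_ab (hcom _ _)
        (hcl _ _ one_ne_zero) hsa' hsb' h1 h2 (eta g hg) rfl rfl
    · left
      -- The values of `m` and `n` solve `j m = 1` and `k m + n = 0`, giving weights `(0, 1)`.
      have h1 := hta' j⁻¹ (-(k * j⁻¹))
      have h2 := htb' j⁻¹ (-(k * j⁻¹))
      rw [show k * j⁻¹ + 1 * -(k * j⁻¹) = 0 by ring] at h1
      rw [mul_inv_cancel₀ hj, zero_mul, add_zero] at h2
      exact nonempty_mulEquiv_of_generators hG ha hb hs'q (hpow _ _) h.commute_ab (hcom _ _)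
        (hcl _ _ (inv_ne_zero hj)) hsa' hsb' h1 h2 (psi g hg) rfl rfl

theorem IsGenerating.nonempty_mulEquiv_zsq [Fact p.Prime] [Fact q.Prime]
    (hG : Nat.card G = (p * q) ^ 2) (hpq : Nat.Coprime p q) (hq : Nat.Coprime q (p - 1))
    {a b s t : G} {u₁ u₂ v : ZMod p} (h : IsGenerating p q a b s t u₁ u₂ v) :
    Nonempty (G ≃* ZSq (p * q)) := by
  obtain rfl : u₁ = 1 :=
    zmod_eq_one_of_pow_eq_one hq (NeZero.ne q) (h.conj_sa.pow_eq_one h.orderOf_a h.s_pow)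
  obtain rfl : u₂ = 1 :=
    zmod_eq_one_of_pow_eq_one hq (NeZero.ne q) (h.conj_ta.pow_eq_one h.orderOf_a h.t_pow)
  obtain rfl : v = 1 :=
    zmod_eq_one_of_pow_eq_one hq (NeZero.ne q) (h.conj_tb.pow_eq_one h.orderOf_b h.t_pow)
  exact h.nonempty_mulEquiv_of_eq_one hG hpq

end Classification

end PQGroups

/-! ### Groups of order `pq` and their automorphisms -/

section PrimeProduct

variable {B : Type*} [Group B] {p q : ℕ} [Fact p.Prime]

theorem index_zpowers_of_orderOf (hB : Nat.card B = p * q) {a : B} (ha : orderOf a = p) :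
    (Subgroup.zpowers a).index = q := by
  have h := (Subgroup.zpowers a).card_mul_index
  rw [Nat.card_zpowers, ha, hB] at h
  exact Nat.eq_of_mul_eq_mul_left (NeZero.pos p) h

variable [Fact q.Prime]

theorem coprime_of_prime_lt (hqp : q < p) : Nat.Coprime p q :=
  (Nat.coprime_primes Fact.out Fact.out).2 hqp.ne'

theorem subgroup_eq_top_of_mem_orderOf (hqp : q < p) (hB : Nat.card B = p * q) {x y : B}
    (hx : orderOf x = p) (hy : orderOf y = q) {K : Subgroup B} (hxK : x ∈ K) (hyK : y ∈ K) :
    K = ⊤ := by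
  have hfin : Finite B := Nat.finite_of_card_ne_zero (hB ▸ NeZero.ne _)
  refine Subgroup.eq_top_of_le_card K (Nat.le_of_dvd Nat.card_pos ?_)
  rw [hB]
  refine (coprime_of_prime_lt hqp).mul_dvd_of_dvd_of_dvd ?_ ?_
  · rw [← hx]; exact Subgroup.orderOf_dvd_natCard K hxK
  · rw [← hy]; exact Subgroup.orderOf_dvd_natCard K hyK

theorem normal_zpowers_of_orderOf (hqp : q < p) (hB : Nat.card B = p * q) {a : B}
    (ha : orderOf a = p) : (Subgroup.zpowers a).Normal := by
  refine Subgroup.normal_of_index_eq_minFac_card ?_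
  rw [index_zpowers_of_orderOf hB ha, hB]
  have hp : p.Prime := Fact.out
  have hq : q.Prime := Fact.out
  have hne : p * q ≠ 1 := fun h => hp.one_lt.ne' (Nat.eq_one_of_mul_eq_one_right h)
  refine le_antisymm ?_ (Nat.minFac_le_of_dvd hq.two_le (Dvd.intro_left p rfl))
  rcases (Nat.minFac_prime hne).dvd_mul.1 (Nat.minFac_dvd _) with h | h
  · rw [(Nat.prime_dvd_prime_iff_eq (Nat.minFac_prime hne) hp).1 h]; exact hqp.le
  · rw [(Nat.prime_dvd_prime_iff_eq (Nat.minFac_prime hne) hq).1 h]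

/-- The image of `y` in the quotient of order `q` is killed by both `p` and `q`. -/
theorem mem_zpowers_of_pow_eq_one (hqp : q < p) (hB : Nat.card B = p * q) {a : B}
    (ha : orderOf a = p) {y : B} (hy : y ^ p = 1) : y ∈ Subgroup.zpowers a := by
  have hN := normal_zpowers_of_orderOf hqp hB ha
  rw [← QuotientGroup.eq_one_iff]
  have h1 : (y : B ⧸ Subgroup.zpowers a) ^ p = 1 := by
    rw [← QuotientGroup.mk_pow, hy, QuotientGroup.mk_one]
  have h2 : (y : B ⧸ Subgroup.zpowers a) ^ q = 1 := by
    rw [← index_zpowers_of_orderOf hB ha, Subgroup.index]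
    exact pow_card_eq_one'
  have h := pow_gcd_eq_one.2 ⟨h1, h2⟩
  rwa [coprime_of_prime_lt hqp, pow_one] at h

theorem iterate_eq_pow_zmod {n : ℕ} [NeZero n] {x : B} (hx : x ^ n = 1) {f : B →* B} {u : ZMod n}
    (h : f x = x ^ u.val) (i : ℕ) : f^[i] x = x ^ (u ^ i).val := by
  induction i with
  | zero => simp [pow_one_val hx]
  | succ i ih =>
    rw [Function.iterate_succ_apply', ih, map_pow, h, pow_succ', pow_zmod_val_mul hx]

/-- An endomorphism of a group of prime order `q` with an iterate of exponent prime to `q - 1`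
equal to the identity is the identity. -/
theorem monoidHom_apply_eq_of_iterate {n : ℕ} (hB : Nat.card B = q) (f : B →* B) (hn0 : n ≠ 0)
    (hn : Nat.Coprime n (q - 1)) (hf : ∀ x, f^[n] x = x) (y : B) : f y = y := by
  by_cases hy : y = 1
  · rw [hy, map_one]
  have hfin : Finite B := Nat.finite_of_card_ne_zero (hB ▸ NeZero.ne _)
  have hyq : y ^ q = 1 := by rw [← hB]; exact pow_card_eq_one'
  have hord : orderOf y = q := orderOf_eq_prime hyq hy
  have hmem : f y ∈ Submonoid.powers y := by
    rw [mem_powers_iff_mem_zpowers]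
    exact mem_zpowers_of_prime_card hB hy
  obtain ⟨k, hk⟩ := hmem
  have hk' : f y = y ^ (k : ZMod q).val := by rw [pow_natCast_val hyq]; exact hk.symm
  have h := iterate_eq_pow_zmod hyq hk' n
  rw [hf] at h
  have hu : (k : ZMod q) ^ n = 1 :=
    zmod_eq_of_pow_val_eq hord (by rw [← h, pow_one_val hyq])
  rw [hk', zmod_eq_one_of_pow_eq_one hn hn0 hu, pow_one_val hyq]

/-- Both primes exceed `q - 1`, which is positive. -/
theorem coprime_mul_pred (hqp : q < p) : Nat.Coprime (p * q) (q - 1) := by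
  have hp : p.Prime := Fact.out
  have hq : q.Prime := Fact.out
  have h1 : 0 < q - 1 := Nat.sub_pos_of_lt hq.one_lt
  refine Nat.Coprime.mul_left ?_ ?_
  · exact Nat.coprime_of_lt_prime h1.ne' (by omega) hp
  · exact Nat.coprime_of_lt_prime h1.ne' (by omega) hq

/-- An automorphism of order dividing `pq` of a group of order `pq` acts trivially modulo the
subgroup of order `p`. -/
theorem inv_mul_apply_mem_zpowers (hqp : q < p) (hB : Nat.card B = p * q) {a : B}
    (ha : orderOf a = p) {σ : MulAut B} (hσ : σ ^ (p * q) = 1) (y : B) :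
    y⁻¹ * σ y ∈ Subgroup.zpowers a := by
  have hN := normal_zpowers_of_orderOf hqp hB ha
  have hle : Subgroup.zpowers a ≤ (Subgroup.zpowers a).comap σ.toMonoidHom := by
    rw [Subgroup.zpowers_le, Subgroup.mem_comap]
    refine mem_zpowers_of_pow_eq_one hqp hB ha ?_
    rw [← map_pow, ← ha, pow_orderOf_eq_one, map_one]
  let f := QuotientGroup.map (Subgroup.zpowers a) (Subgroup.zpowers a) σ.toMonoidHom hle
  have hf : ∀ (i : ℕ) (y : B), f^[i] (y : B ⧸ Subgroup.zpowers a) = ((σ ^ i) y : B) := by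
    intro i y
    induction i with
    | zero => rfl
    | succ i ih => rw [Function.iterate_succ_apply', ih, pow_succ']; rfl
  have h := monoidHom_apply_eq_of_iterate (index_zpowers_of_orderOf hB ha) f (NeZero.ne (p * q))
    (coprime_mul_pred hqp) (fun x => by
      obtain ⟨y, rfl⟩ := QuotientGroup.mk_surjective x
      rw [hf, hσ, MulAut.one_apply]) y
  rw [← QuotientGroup.eq]
  exact h.symm

end PrimeProduct

/-! ### Elements of order `p` and `q` in a brace of size `pq` -/

namespace SkewLeftBrace

open SemidirectProduct

variable {A : Type*} [SkewLeftBrace A]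

theorem val_mul_eq (x y : Circ A) : (x * y).val = x.val * lambdaHom A x y.val :=
  (mul_inv_cancel_left x.val (circ x.val y.val)).symm

theorem val_one : (1 : Circ A).val = 1 := circOne_eq

/-- The identification of the two groups of a brace as sets. -/
def circEquiv (A : Type*) : Circ A ≃ A := ⟨Circ.val, Circ.mk, fun _ => rfl, fun _ => rfl⟩

theorem card_circ {A : Type*} : Nat.card (Circ A) = Nat.card A := Nat.card_congr (circEquiv A)

theorem inr_conj_inl (x : Circ A) (y : A) :
    (inr x * inl y * (inr x)⁻¹ : Lambda A) = inl (lambdaHom A x y) := by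
  rw [inl_aut, map_inv]

theorem val_pow_of_fixed {c : Circ A} (h : lambdaHom A c c.val = c.val) (k : ℕ) :
    (c ^ k).val = c.val ^ k := by
  induction k with
  | zero => rw [pow_zero, pow_zero, val_one]
  | succ k ih => rw [pow_succ', pow_succ', val_mul_eq, ih, map_pow, h]

theorem lambdaHom_pow_eq_one {p q : ℕ} (hA : Nat.card A = p * q) (x : Circ A) :
    lambdaHom A x ^ (p * q) = 1 := by
  rw [← map_pow, ← hA, ← card_circ, pow_card_eq_one', map_one]

theorem card_lambda {p q : ℕ} (hA : Nat.card A = p * q) : Nat.card (Lambda A) = (p * q) ^ 2 := by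
  rw [SemidirectProduct.card, card_circ, hA, sq]

section Order

variable {p q : ℕ} [Fact p.Prime] [Fact q.Prime]

/-- An element of order `p` of `(A, ·)` has order `p` in `(A, ∘)`. -/
theorem orderOf_circ (hqp : q < p) (hA : Nat.card A = p * q) {a : A}
    (ha : orderOf a = p) :
    orderOf (⟨a⟩ : Circ A) = p := by
  have hN := normal_zpowers_of_orderOf hqp hA ha
  have hfin : Finite A := Nat.finite_of_card_ne_zero (hA ▸ NeZero.ne _)
  have hfin' : Finite (Circ A) := Finite.of_equiv _ (circEquiv A).symm
  -- Since `x ∘ y = x · λ_x(y)` and `λ_x` is trivial modulo `⟨a⟩`, the quotient map is also a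
  -- homomorphism for `∘`. Its kernel is the set `⟨a⟩`, a group of order `p` for `∘`.
  let κ : Circ A →* A ⧸ Subgroup.zpowers a := MonoidHom.mk' (fun x => (x.val : A ⧸ _)) (by
    intro x y
    rw [val_mul_eq, QuotientGroup.mk_mul]
    congr 1
    exact (QuotientGroup.eq.2
      (inv_mul_apply_mem_zpowers hqp hA ha (lambdaHom_pow_eq_one hA x) y.val)).symm)
  have hker : ∀ x : Circ A, x ∈ κ.ker ↔ x.val ∈ Subgroup.zpowers a := fun x =>
    QuotientGroup.eq_one_iff x.val
  have hcard : Nat.card κ.ker = p := by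
    rw [← ha, ← Nat.card_zpowers]
    exact Nat.card_congr ((circEquiv A).subtypeEquiv hker)
  have hc : (⟨a⟩ : Circ A) ∈ κ.ker := (hker _).2 (Subgroup.mem_zpowers a)
  refine orderOf_eq_prime ?_ ?_
  · have h : (⟨⟨a⟩, hc⟩ : κ.ker) ^ p = 1 := by rw [← hcard]; exact pow_card_eq_one'
    exact congrArg Subtype.val h
  · intro h
    have h1 : a = 1 := (congrArg Circ.val h).trans val_one
    rw [h1, orderOf_one] at ha
    exact (Fact.out : p.Prime).one_lt.ne ha

/-- Some
element of order `q` of `(A, ·)` is fixed by `λ_t` when `t` has order `q`. -/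
theorem exists_fixed_orderOf (hqp : q < p) (hA : Nat.card A = p * q) {t : Circ A}
    (ht : orderOf t = q) : ∃ s : A, orderOf s = q ∧ lambdaHom A t s = s := by
  have hp : p.Prime := Fact.out
  have hq : q.Prime := Fact.out
  have hfin : Finite A := Nat.finite_of_card_ne_zero (hA ▸ NeZero.ne _)
  have hfin' : Finite (Circ A) := Finite.of_equiv _ (circEquiv A).symm
  have hcard : Nat.card (Lambda A) = (p * q) ^ 2 := card_lambda hA
  have hfinL : Finite (Lambda A) :=
    Nat.finite_of_card_ne_zero (hcard ▸ pow_ne_zero _ (NeZero.ne _))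
  have htL : orderOf (inr t : Lambda A) = q := by
    rw [orderOf_injective _ inr_injective, ht]
  have hpg : IsPGroup q (Subgroup.zpowers (inr t : Lambda A)) :=
    IsPGroup.of_card (n := 1) (by rw [Nat.card_zpowers, htL, pow_one])
  obtain ⟨Q, hQ⟩ := hpg.exists_le_sylow
  have hQcard : Nat.card Q = q ^ 2 := by
    rw [Sylow.card_eq_multiplicity, hcard, Nat.factorization_pow,
      Nat.factorization_mul hp.ne_zero hq.ne_zero, hp.factorization, hq.factorization]
    simp [hqp.ne']
  have hQcomm : ∀ x y : Q, x * y = y * x := 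
    (IsPGroup.isMulCommutative_of_card_eq_prime_sq hQcard).is_comm.comm
  let f : Q →* Circ A := rightHom.comp Q.toSubgroup.subtype
  -- An embedding of `Q` in `(A,∘)` would give `q² ∣ pq`.
  have hninj : ¬ Function.Injective f := by
    intro hinj
    have h := Subgroup.card_dvd_of_injective f hinj
    rw [hQcard, card_circ, hA, sq] at h
    have h2 := Nat.dvd_of_mul_dvd_mul_right hq.pos h
    exact hqp.ne ((Nat.prime_dvd_prime_iff_eq hq hp).1 h2)
  rw [injective_iff_map_eq_one] at hninj
  push Not at hninj
  obtain ⟨z, hz, hz1⟩ := hninj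
  have hzr : z.1 ∈ (rightHom : Lambda A →* Circ A).ker := hz
  rw [← range_inl_eq_ker_rightHom] at hzr
  obtain ⟨s, hs⟩ := hzr
  have hzq : z ^ (q ^ 2) = 1 := by rw [← hQcard]; exact pow_card_eq_one'
  have hsq : s ^ (q ^ 2) = 1 := by
    apply inl_injective (φ := lambdaHom A)
    rw [map_pow, hs, map_one]
    exact congrArg Subtype.val hzq
  have hspq : s ^ (p * q) = 1 := by rw [← hA]; exact pow_card_eq_one'
  have hs1 : s ≠ 1 := by
    rintro rfl
    exact hz1 (Subtype.ext (by rw [← hs, map_one]; rfl))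
  refine ⟨s, orderOf_eq_prime ?_ hs1, ?_⟩
  · have h := pow_gcd_eq_one.2 ⟨hsq, hspq⟩
    rwa [sq, Nat.gcd_mul_right, (coprime_of_prime_lt hqp).symm, one_mul] at h
  · apply inl_injective (φ := lambdaHom A)
    have h := congrArg Subtype.val (hQcomm ⟨inr t, hQ (Subgroup.mem_zpowers _)⟩ z)
    change inr t * z.1 = z.1 * inr t at h
    rw [← hs] at h
    rw [← inr_conj_inl, h, mul_inv_cancel_right]

end Order

end SkewLeftBrace

/-! ### Generators of `Λ_A` -/

namespace SkewLeftBrace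

open SemidirectProduct PQGroups

variable {A : Type*} [SkewLeftBrace A] {p q : ℕ} [Fact p.Prime] [Fact q.Prime]

theorem closure_eq_top (hqp : q < p) (hA : Nat.card A = p * q) {a s : A} {c t : Circ A}
    (ha : orderOf a = p) (hs : orderOf s = q) (hc : orderOf c = p) (ht : orderOf t = q) (m : ℕ) :
    Subgroup.closure {(inl a : Lambda A), inl (a ^ m) * inr c, inl s, inr t} = ⊤ := by
  set H := Subgroup.closure {(inl a : Lambda A), inl (a ^ m) * inr c, inl s, inr t}
  have haH : inl a ∈ H := Subgroup.subset_closure (by simp)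
  have hbH : inl (a ^ m) * inr c ∈ H := Subgroup.subset_closure (by simp)
  have hsH : inl s ∈ H := Subgroup.subset_closure (by simp)
  have htH : inr t ∈ H := Subgroup.subset_closure (by simp)
  have hcH : inr c ∈ H := by
    rw [map_pow] at hbH
    exact (Subgroup.mul_mem_cancel_left H (H.pow_mem haH m)).1 hbH
  have h1 : H.comap inl = ⊤ := subgroup_eq_top_of_mem_orderOf hqp hA ha hs haH hsH
  have h2 : H.comap inr = ⊤ :=
    subgroup_eq_top_of_mem_orderOf hqp (card_circ.trans hA) hc ht hcH htH
  rw [eq_top_iff]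
  intro x _
  rw [← inl_left_mul_inr_right x]
  have h1' : x.left ∈ H.comap inl := h1 ▸ Subgroup.mem_top _
  have h2' : x.right ∈ H.comap inr := h2 ▸ Subgroup.mem_top _
  exact H.mul_mem h1' h2'

/-- `λ_a` raises `a` to a power `u` with `u ^ p = 1` in `ZMod p`, and `p` is prime to `p - 1`. -/
theorem lambdaHom_apply_self (hA : Nat.card A = p * q) (hqp : q < p) {a : A}
    (ha : orderOf a = p) : lambdaHom A ⟨a⟩ a = a := by
  have hp : p.Prime := Fact.out
  have hap : a ^ p = 1 := ha ▸ pow_orderOf_eq_one a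
  have haL : orderOf (inl a : Lambda A) = p := by rw [orderOf_injective _ inl_injective, ha]
  have hmem : lambdaHom A ⟨a⟩ a ∈ Subgroup.zpowers a :=
    mem_zpowers_of_pow_eq_one hqp hA ha (by rw [← map_pow, hap, map_one])
  obtain ⟨u, hu⟩ := exists_conjPow_of_mem (n := p) (x := (inl a : Lambda A)) (z := inr ⟨a⟩)
    (by rw [← map_pow, hap, map_one])
    (by rw [inr_conj_inl, ← MonoidHom.map_zpowers]; exact Subgroup.mem_map_of_mem _ hmem)
  have hcp : (inr ⟨a⟩ : Lambda A) ^ p = 1 := by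
    rw [← map_pow, orderOf_dvd_iff_pow_eq_one.1 (orderOf_circ hqp hA ha).dvd, map_one]
  have hu1 : u = 1 := by
    refine zmod_eq_one_of_pow_eq_one ?_ hp.ne_zero (hu.pow_eq_one haL hcp)
    exact Nat.coprime_of_lt_prime (Nat.sub_pos_of_lt hp.one_lt).ne'
      (Nat.sub_lt hp.pos one_pos) hp
  rw [hu1, ConjPow, pow_one_val (by rw [← map_pow, hap, map_one]), inr_conj_inl] at hu
  exact inl_injective hu

/-- Here `a` is central in `(A,·)` and `λ_a` is trivial, so the copy of `a` in `(A,∘)` already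
serves as `b`. -/
theorem isGenerating_of_commute (hqp : q < p) (hA : Nat.card A = p * q) {a s : A}
    {t : Circ A} (ha : orderOf a = p) (hs : orderOf s = q) (ht : orderOf t = q)
    (hts : lambdaHom A t s = s) {u₁ u₂ : ZMod p} (hsa : ConjPow (inl s : Lambda A) (inl a) u₁)
    (hta : ConjPow (inr t : Lambda A) (inl a) u₂) (hcomm : Commute s a) :
    IsGenerating p q (inl a : Lambda A) (inr ⟨a⟩) (inl s) (inr t) u₁ u₂ u₂ := by
  have hap : a ^ p = 1 := ha ▸ pow_orderOf_eq_one a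
  have hsq : s ^ q = 1 := hs ▸ pow_orderOf_eq_one s
  have htq : t ^ q = 1 := ht ▸ pow_orderOf_eq_one t
  have hc := orderOf_circ hqp hA ha
  have hca := lambdaHom_apply_self hA hqp ha
  have hcen : ∀ y : A, Commute a y := by
    have h : Subgroup.centralizer {a} = ⊤ :=
      subgroup_eq_top_of_mem_orderOf hqp hA ha hs
        (Subgroup.mem_centralizer_singleton_iff.2 rfl)
        (Subgroup.mem_centralizer_singleton_iff.2 hcomm.eq)
    intro y
    have hy : y ∈ Subgroup.centralizer {a} := h ▸ Subgroup.mem_top y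
    exact (Subgroup.mem_centralizer_singleton_iff.1 hy).symm
  -- The factor `a ^ k` by which `λ_a` moves `s` commutes with `s`, so it is killed by `q` as well
  -- as by `p`.
  have hcs : lambdaHom A ⟨a⟩ s = s := by
    obtain ⟨k, hk⟩ := inv_mul_apply_mem_zpowers hqp hA ha (lambdaHom_pow_eq_one hA ⟨a⟩) s
    have hk' : lambdaHom A ⟨a⟩ s = s * a ^ k := by
      rw [show a ^ k = _ from hk, mul_inv_cancel_left]
    have h1 : (a ^ k) ^ q = 1 := by
      have h := congrArg (· ^ q) hk'
      simpa only [← map_pow, hsq, map_one, (hcomm.zpow_right k).mul_pow, one_mul, eq_comm] using h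
    have h2 : (a ^ k) ^ p = 1 := by rw [← zpow_natCast, zpow_comm, zpow_natCast, hap, one_zpow]
    have h3 := pow_gcd_eq_one.2 ⟨h2, h1⟩
    rw [coprime_of_prime_lt hqp, pow_one] at h3
    rw [hk', h3, mul_one]
  have hfix : lambdaHom A ⟨a⟩ = 1 := by
    have h : (lambdaHom A ⟨a⟩).toMonoidHom.eqLocus (MonoidHom.id A) = ⊤ :=
      subgroup_eq_top_of_mem_orderOf hqp hA ha hs hca hcs
    ext y
    have hy : y ∈ (lambdaHom A ⟨a⟩).toMonoidHom.eqLocus (MonoidHom.id A) := h ▸ Subgroup.mem_top y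
    exact hy
  have htc : ConjPow t (⟨a⟩ : Circ A) u₂ := by
    rw [ConjPow, mul_inv_eq_iff_eq_mul]
    apply Circ.ext
    -- This gives `t ∘ a = t · a ^ u₂`. The other side is `a ^ u₂ · t` because `λ_a` is trivial and
    -- powers of `a` agree in both groups; centrality of `a` equates them.
    have h1 : lambdaHom A t a = a ^ u₂.val := by
      rw [ConjPow, inr_conj_inl, ← map_pow] at hta
      exact inl_injective hta
    rw [val_mul_eq, val_mul_eq, val_pow_of_fixed hca, h1, map_pow, hfix, one_pow,
      MulAut.one_apply]
    exact ((hcen t.val).pow_left _).eq.symm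
  have hclo := closure_eq_top hqp hA ha hs hc ht 0
  rw [pow_zero, map_one, one_mul] at hclo
  exact
    { orderOf_a := by rw [orderOf_injective _ inl_injective, ha]
      orderOf_b := by rw [orderOf_injective _ inr_injective, hc]
      s_pow := by rw [← map_pow, hsq, map_one]
      t_pow := by rw [← map_pow, htq, map_one]
      commute_ab := (mul_inv_eq_iff_eq_mul.1 ((inr_conj_inl _ _).trans (by rw [hca]))).symm
      commute_st := (mul_inv_eq_iff_eq_mul.1 ((inr_conj_inl _ _).trans (by rw [hts]))).symm
      commute_sb := (mul_inv_eq_iff_eq_mul.1 ((inr_conj_inl _ _).trans (by rw [hcs]))).symm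
      conj_sa := hsa
      conj_ta := hta
      conj_tb := by
        have h := congrArg (inr : Circ A →* Lambda A) htc
        rwa [map_mul, map_mul, map_inv, map_pow] at h
      eq_of_eq_one := fun _ => rfl
      closure_eq := hclo }

/-- As `u₁ ≠ 1`, no nontrivial power of `a` commutes with `s`. This makes the correction of `b`
solvable and forces `t` to normalize `⟨b⟩`. -/
theorem exists_isGenerating_of_not_commute (hqp : q < p) (hA : Nat.card A = p * q) {a s : A}
    {t : Circ A} (ha : orderOf a = p) (hs : orderOf s = q) (ht : orderOf t = q)
    (hts : lambdaHom A t s = s) {u₁ u₂ : ZMod p} (hsa : ConjPow (inl s : Lambda A) (inl a) u₁)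
    (hta : ConjPow (inr t : Lambda A) (inl a) u₂) (hu : u₁ ≠ 1) :
    ∃ (b : Lambda A) (v : ZMod p), IsGenerating p q (inl a : Lambda A) b (inl s) (inr t) u₁ u₂ v := by
  have hap : a ^ p = 1 := ha ▸ pow_orderOf_eq_one a
  have hsq : s ^ q = 1 := hs ▸ pow_orderOf_eq_one s
  have htq : t ^ q = 1 := ht ▸ pow_orderOf_eq_one t
  have haL : orderOf (inl a : Lambda A) = p := by rw [orderOf_injective _ inl_injective, ha]
  have hapL : (inl a : Lambda A) ^ p = 1 := by rw [← map_pow, hap, map_one]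
  have hc := orderOf_circ hqp hA ha
  have hcp : (⟨a⟩ : Circ A) ^ p = 1 := orderOf_dvd_iff_pow_eq_one.1 hc.dvd
  have hca := lambdaHom_apply_self hA hqp ha
  have hac : Commute (inl a : Lambda A) (inr ⟨a⟩) :=
    (mul_inv_eq_iff_eq_mul.1 ((inr_conj_inl _ _).trans (by rw [hca]))).symm
  have hst : Commute (inl s : Lambda A) (inr t) :=
    (mul_inv_eq_iff_eq_mul.1 ((inr_conj_inl _ _).trans (by rw [hts]))).symm
  have hsa' : s * a * s⁻¹ = a ^ u₁.val := by
    apply inl_injective (φ := lambdaHom A)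
    rw [map_mul, map_mul, map_inv, map_pow]
    exact hsa
  have hsaA : ConjPow s a u₁ := hsa'
  have hfin : IsOfFinOrder a := isOfFinOrder_iff_pow_eq_one.2 ⟨p, NeZero.pos p, hap⟩
  obtain ⟨j, hj⟩ := hfin.mem_powers_iff_mem_zpowers.2
    (inv_mul_apply_mem_zpowers hqp hA ha (lambdaHom_pow_eq_one hA ⟨a⟩) s)
  have hj' : lambdaHom A ⟨a⟩ s = s * a ^ (j : ZMod p).val := by
    rw [pow_natCast_val hap, show a ^ j = _ from hj, mul_inv_cancel_left]
  -- With `λ_a(s) = s a ^ j`, moving `s` to the right of the powers of `a` in `b s = s b` yields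
  -- exactly this equation for `m`.
  obtain ⟨m, hm⟩ : ∃ m : ZMod p, m + j * u₁ = m * u₁ := by
    have h0 : u₁ - 1 ≠ 0 := sub_ne_zero.2 hu
    exact ⟨j * u₁ / (u₁ - 1), by field_simp; ring⟩
  have hpowa : ∀ k : ZMod p, s * a ^ k.val = a ^ (k * u₁).val * s := fun k => by
    rw [pow_zmod_val_mul hap]; exact mul_inv_eq_iff_eq_mul.1 (hsaA.conj_pow _)
  set b : Lambda A := inl (a ^ m.val) * inr ⟨a⟩ with hb
  have hab : Commute (inl a : Lambda A) b := by
    rw [hb, map_pow]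
    exact ((Commute.refl _).pow_right _).mul_right hac
  have hsb : Commute (inl s : Lambda A) b := by
    have h1 : (inr ⟨a⟩ : Lambda A) * inl s = inl (s * a ^ (j : ZMod p).val) * inr ⟨a⟩ := by
      rw [← hj']; exact mul_inv_eq_iff_eq_mul.1 (inr_conj_inl _ _)
    change inl s * b = b * inl s
    rw [hb, mul_assoc _ _ (inl s), h1, ← mul_assoc, ← mul_assoc, ← map_mul, ← map_mul, hpowa,
      hpowa, ← mul_assoc, ← pow_zmod_val_add hap, hm]
  have hbp : b ^ p = 1 := by
    have h : Commute (inl (a ^ m.val) : Lambda A) (inr ⟨a⟩) := by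
      rw [map_pow]; exact hac.pow_left _
    rw [hb, h.mul_pow, ← map_pow, ← map_pow, hcp, pow_right_comm, hap, one_pow, map_one, map_one,
      one_mul]
  have hbr : rightHom b = (⟨a⟩ : Circ A) := by
    rw [hb, map_mul, rightHom_inl, rightHom_inr, one_mul]
  have hb1 : b ≠ 1 := by
    intro h
    rw [h, map_one] at hbr
    rw [← hbr, orderOf_one] at hc
    exact (Fact.out : p.Prime).one_lt.ne hc
  have hNc := normal_zpowers_of_orderOf hqp (card_circ.trans hA) hc
  obtain ⟨v, hv⟩ := exists_conjPow_of_mem hcp (z := t)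
    (hNc.conj_mem _ (Subgroup.mem_zpowers _) t)
  have htb : ConjPow (inr t : Lambda A) b v := by
    -- The defect `d` projects to `1` in `(A,∘)`, has `d ^ p = 1` and commutes with `s`. So it is a
    -- power of `a` centralized by `s`, hence trivial.
    set d : Lambda A := inr t * b * (inr t)⁻¹ * (b ^ v.val)⁻¹ with hd
    have hdr : rightHom d = 1 := by
      rw [hd, map_mul, map_mul, map_mul, map_inv, map_inv, map_pow, hbr, rightHom_inr, hv,
        mul_inv_cancel]
    have hds : Commute (inl s) d := by
      refine Commute.mul_right (Commute.mul_right (Commute.mul_right hst hsb) hst.inv_right) ?_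
      exact (hsb.pow_right _).inv_right
    have hda : Commute (inl s) d → d ∈ (inl : A →* Lambda A).range → d ^ p = 1 → d = 1 := by
      rintro h ⟨y, hy⟩ hdp
      rw [← hy] at h hdp ⊢
      have hyp : y ^ p = 1 := by
        apply inl_injective (φ := lambdaHom A)
        rw [map_pow, hdp, map_one]
      obtain ⟨k, hk⟩ := hfin.mem_powers_iff_mem_zpowers.2
        (mem_zpowers_of_pow_eq_one hqp hA ha hyp)
      have hk' : y = a ^ (k : ZMod p).val := by rw [pow_natCast_val hap]; exact hk.symm
      have hys : s * y = y * s := by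
        apply inl_injective (φ := lambdaHom A)
        rw [map_mul, map_mul]; exact h
      rw [hk', hpowa] at hys
      have h1 := zmod_eq_of_pow_val_eq ha (mul_right_cancel hys)
      have h2 : (k : ZMod p) * (u₁ - 1) = 0 := by rw [mul_sub, h1, mul_one, sub_self]
      have h3 := (mul_eq_zero.1 h2).resolve_right (sub_ne_zero.2 hu)
      rw [hk', h3, ZMod.val_zero, pow_zero, map_one]
    -- Needed to distribute the `p`-th power over the two factors of `d`.
    have hcomm : Commute (inr t * b * (inr t)⁻¹) (b ^ v.val) := by
      have h1 : inr t * b * (inr t)⁻¹ =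
          (inl a ^ m.val) ^ u₂.val * (inr ⟨a⟩ : Lambda A) ^ v.val := by
        have h2 := congrArg (inr : Circ A →* Lambda A) hv
        rw [map_mul, map_mul, map_inv, map_pow] at h2
        rw [hb, ← conj_mul, map_pow, hta.conj_pow, h2]
      have hcb : Commute (inr ⟨a⟩) b := by
        rw [hb, map_pow]
        exact (hac.symm.pow_right _).mul_right (Commute.refl _)
      rw [h1]
      exact (((hab.pow_left _).pow_left _).mul_left (hcb.pow_left _)).pow_right _
    have hdp : d ^ p = 1 := by
      rw [hd, hcomm.inv_right.mul_pow, _root_.conj_pow, hbp, mul_one, mul_inv_cancel, inv_pow,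
        pow_right_comm, hbp, one_pow, inv_one, mul_one]
    have h := hda hds (by rw [range_inl_eq_ker_rightHom]; exact hdr) hdp
    exact mul_inv_eq_one.1 h
  exact ⟨b, v,
    { orderOf_a := haL
      orderOf_b := orderOf_eq_prime hbp hb1
      s_pow := by rw [← map_pow, hsq, map_one]
      t_pow := by rw [← map_pow, htq, map_one]
      commute_ab := hab
      commute_st := hst
      commute_sb := hsb
      conj_sa := hsa
      conj_ta := hta
      conj_tb := htb
      eq_of_eq_one := fun h => absurd h hu
      closure_eq := closure_eq_top hqp hA ha hs hc ht _ }⟩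

theorem exists_isGenerating (hqp : q < p) (hA : Nat.card A = p * q) :
    ∃ (a b s t : Lambda A) (u₁ u₂ v : ZMod p), IsGenerating p q a b s t u₁ u₂ v := by
  have hfin : Finite A := Nat.finite_of_card_ne_zero (hA ▸ NeZero.ne _)
  have hfin' : Finite (Circ A) := Finite.of_equiv _ (circEquiv A).symm
  obtain ⟨a, ha⟩ := exists_prime_orderOf_dvd_card' (G := A) p (hA ▸ Dvd.intro q rfl)
  obtain ⟨t, ht⟩ := exists_prime_orderOf_dvd_card' (G := Circ A) q
    ((card_circ.trans hA) ▸ Dvd.intro_left p rfl)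
  obtain ⟨s, hs, hts⟩ := exists_fixed_orderOf hqp hA ht
  have hap : a ^ p = 1 := ha ▸ pow_orderOf_eq_one a
  have hapL : (inl a : Lambda A) ^ p = 1 := by rw [← map_pow, hap, map_one]
  have hconj : ∀ z : Lambda A, ∃ u : ZMod p, ConjPow z (inl a) u := by
    intro z
    refine exists_conjPow_of_mem hapL ?_
    obtain ⟨y, hy⟩ : z * inl a * z⁻¹ ∈ (inl : A →* Lambda A).range := by
      rw [range_inl_eq_ker_rightHom, MonoidHom.mem_ker, map_mul, map_mul, map_inv, rightHom_inl,
        mul_one, mul_inv_cancel]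
    have hyp : y ^ p = 1 := by
      apply inl_injective (φ := lambdaHom A)
      rw [map_pow, hy, _root_.conj_pow, hapL, mul_one, mul_inv_cancel, map_one]
    rw [← hy, ← MonoidHom.map_zpowers]
    exact Subgroup.mem_map_of_mem _ (mem_zpowers_of_pow_eq_one hqp hA ha hyp)
  obtain ⟨u₁, hsa⟩ := hconj (inl s)
  obtain ⟨u₂, hta⟩ := hconj (inr t)
  by_cases hu : u₁ = 1
  · have hcomm : Commute s a := by
      subst hu
      apply inl_injective (φ := lambdaHom A)
      rw [map_mul, map_mul]
      exact hsa.commute hapL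
    exact ⟨_, _, _, _, _, _, _,
      isGenerating_of_commute hqp hA ha hs ht hts hsa hta hcomm⟩
  · obtain ⟨b, v, h⟩ := exists_isGenerating_of_not_commute hqp hA ha hs ht hts hsa hta hu
    exact ⟨_, _, _, _, _, _, _, h⟩

end SkewLeftBrace

/-! ### Distinguishing the four groups by their centres -/

namespace PQGroups

open SemidirectProduct

theorem fixed_of_mem_center {N H : Type*} [CommGroup N] [Group H] {φ : H →* MulAut N}
    {z : N ⋊[φ] H} (hz : z ∈ Subgroup.center (N ⋊[φ] H)) :
    (∀ n, φ z.right n = n) ∧ ∀ k, φ k z.left = z.left := by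
  rw [Subgroup.mem_center_iff] at hz
  constructor
  · intro n
    have h := congrArg SemidirectProduct.left (hz (inl n))
    simp only [mul_left, left_inl, right_inl, map_one, MulAut.one_apply] at h
    rw [mul_comm n] at h
    exact (mul_left_cancel h).symm
  · intro k
    simpa using congrArg SemidirectProduct.left (hz (inr k))

theorem apply_mem_center {G H : Type*} [Group G] [Group H] (e : G ≃* H) {z : G}
    (hz : z ∈ Subgroup.center G) : e z ∈ Subgroup.center H := by
  rw [Subgroup.mem_center_iff] at hz ⊢
  intro w
  obtain ⟨w, rfl⟩ := e.surjective w
  rw [← map_mul, ← map_mul, hz]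

/-- An isomorphism would make every `inr l` central, so that every `φ l` is trivial. -/
theorem isEmpty_zsq_mulEquiv {m n k : ℕ} {φ : ZSq n →* MulAut (ZSq k)} (hφ : φ ≠ 1) :
    IsEmpty (ZSq m ≃* ZSq k ⋊[φ] ZSq n) := by
  refine ⟨fun e => hφ ?_⟩
  have hc : ∀ z : ZSq k ⋊[φ] ZSq n, z ∈ Subgroup.center _ := fun z => by
    rw [← e.apply_symm_apply z]
    exact apply_mem_center e (Subgroup.mem_center_iff.2 fun w => mul_comm _ _)
  refine MonoidHom.ext fun l => MulEquiv.ext fun x => ?_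
  exact (fixed_of_mem_center (hc (inr l))).1 x

section Actions

variable {p q : ℕ} [Fact p.Prime] [Fact q.Prime] {g : (ZMod p)ˣ}

theorem diagAut_apply (u v : (ZMod p)ˣ) (n : ZSq p) :
    diagAut u v n = Multiplicative.ofAdd ((u : ZMod p) * n.toAdd.1, (v : ZMod p) * n.toAdd.2) :=
  rfl

theorem theta_apply (hg : orderOf g = q) (k : ZSq q) :
    theta g hg k = diagAut (g ^ k.toAdd.2.val) (g ^ k.toAdd.2.val) := rfl

theorem psi_apply (hg : orderOf g = q) (k : ZSq q) :
    psi g hg k = diagAut (g ^ k.toAdd.1.val) (g ^ k.toAdd.2.val) := rfl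

theorem eta_apply (hg : orderOf g = q) (k : ZSq q) :
    eta g hg k = diagAut (g ^ (k.toAdd.1 + k.toAdd.2).val) 1 := rfl

theorem diagAut_one_one : diagAut (1 : (ZMod p)ˣ) 1 = 1 := by
  ext n <;> simp [diagAut]

theorem diagAut_injective {u v u' v' : (ZMod p)ˣ} (h : diagAut u v = diagAut u' v') :
    u = u' ∧ v = v' := by
  have h1 := congrArg Multiplicative.toAdd
    (DFunLike.congr_fun h (Multiplicative.ofAdd ((1, 1) : ZMod p × ZMod p)))
  simp only [diagAut_apply, toAdd_ofAdd, mul_one, Prod.mk.injEq, Units.val_inj] at h1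
  exact h1

theorem pow_val_eq_one_iff (hg : orderOf g = q) {i : ZMod q} : g ^ i.val = 1 ↔ i = 0 := by
  constructor
  · intro h
    exact zmod_eq_of_pow_val_eq hg (by rw [h, ZMod.val_zero, pow_zero])
  · rintro rfl
    rw [ZMod.val_zero, pow_zero]

theorem eq_zero_of_mul_eq (hg : orderOf g = q) {x : ZMod p}
    (h : ((g ^ (1 : ZMod q).val : (ZMod p)ˣ) : ZMod p) * x = x) :
    x = 0 := by
  by_contra hx
  have h1 := (mul_eq_right₀ hx).1 h
  rw [Units.val_eq_one, pow_val_eq_one_iff hg] at h1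
  exact one_ne_zero h1

theorem theta_ne_one (hg : orderOf g = q) : theta g hg ≠ 1 := by
  intro h
  have h1 := DFunLike.congr_fun h (Multiplicative.ofAdd (0, 1))
  rw [theta_apply, MonoidHom.one_apply, ← diagAut_one_one] at h1
  exact one_ne_zero ((pow_val_eq_one_iff hg).1 (diagAut_injective h1).1)

theorem psi_ne_one (hg : orderOf g = q) : psi g hg ≠ 1 := by
  intro h
  have h1 := DFunLike.congr_fun h (Multiplicative.ofAdd (1, 0))
  rw [psi_apply, MonoidHom.one_apply, ← diagAut_one_one] at h1
  exact one_ne_zero ((pow_val_eq_one_iff hg).1 (diagAut_injective h1).1)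

theorem eta_ne_one (hg : orderOf g = q) : eta g hg ≠ 1 := by
  intro h
  have h1 := DFunLike.congr_fun h (Multiplicative.ofAdd (1, 0))
  rw [eta_apply, MonoidHom.one_apply, ← diagAut_one_one] at h1
  have h2 := (pow_val_eq_one_iff hg).1 (diagAut_injective h1).1
  rw [toAdd_ofAdd, add_zero] at h2
  exact one_ne_zero h2

/-- The action `psi` is faithful and has no nonzero fixed vector, which kills the right and left
components of a central element respectively. -/
theorem center_psi (hg : orderOf g = q) : Subgroup.center (ZSq p ⋊[psi g hg] ZSq q) = ⊥ := by
  rw [eq_bot_iff]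
  intro z hz
  obtain ⟨h1, h2⟩ := fixed_of_mem_center hz
  have h3 : psi g hg z.right = diagAut 1 1 := by
    rw [diagAut_one_one]; ext1 n; exact h1 n
  have h4 := diagAut_injective h3
  rw [pow_val_eq_one_iff hg, pow_val_eq_one_iff hg] at h4
  have h5 := congrArg (fun n : ZSq p => n.toAdd.1) (h2 (Multiplicative.ofAdd (1, 0)))
  have h6 := congrArg (fun n : ZSq p => n.toAdd.2) (h2 (Multiplicative.ofAdd (0, 1)))
  rw [Subgroup.mem_bot]
  refine SemidirectProduct.ext ?_ ?_
  · exact Multiplicative.toAdd.injective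
      (Prod.ext (eq_zero_of_mul_eq hg h5) (eq_zero_of_mul_eq hg h6))
  · exact Multiplicative.toAdd.injective (Prod.ext h4.1 h4.2)

theorem inr_mem_center_theta (hg : orderOf g = q) :
    (inr (Multiplicative.ofAdd (1, 0)) : ZSq p ⋊[theta g hg] ZSq q) ∈ Subgroup.center _ := by
  rw [Subgroup.mem_center_iff]
  intro w
  have h : theta g hg (Multiplicative.ofAdd (1, 0)) = 1 := by
    rw [theta_apply, toAdd_ofAdd, ZMod.val_zero, pow_zero, diagAut_one_one]
  refine SemidirectProduct.ext ?_ ?_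
  · rw [mul_left, mul_left, left_inr, map_one, right_inr, h, one_mul, mul_one, MulAut.one_apply]
  · rw [mul_right, mul_right, mul_comm]

theorem inl_mem_center_eta (hg : orderOf g = q) :
    (inl (Multiplicative.ofAdd (0, 1)) : ZSq p ⋊[eta g hg] ZSq q) ∈ Subgroup.center _ := by
  rw [Subgroup.mem_center_iff]
  intro w
  have h : ∀ k, eta g hg k (Multiplicative.ofAdd (0, 1)) = Multiplicative.ofAdd (0, 1) := by
    intro k
    simp [eta_apply, diagAut_apply]
  refine SemidirectProduct.ext ?_ ?_
  · rw [mul_left, mul_left, left_inl, right_inl, map_one, h, mul_comm, MulAut.one_apply]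
  · rw [mul_right, mul_right, mul_comm]

/-- `(0,1)` acts by the scalar `g ≠ 1`, so a central element has trivial left component; its right
component is killed by `p` and `q`. -/
theorem eq_one_of_mem_center_theta (hg : orderOf g = q) (hpq : Nat.Coprime p q)
    {z : ZSq p ⋊[theta g hg] ZSq q}
    (hz : z ∈ Subgroup.center _) (hzp : z ^ p = 1) : z = 1 := by
  obtain ⟨-, h2⟩ := fixed_of_mem_center hz
  have h := h2 (Multiplicative.ofAdd (0, 1))
  refine SemidirectProduct.ext ?_ ?_
  · exact Multiplicative.toAdd.injective
      (Prod.ext (eq_zero_of_mul_eq hg (congrArg (fun n : ZSq p => n.toAdd.1) h))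
        (eq_zero_of_mul_eq hg (congrArg (fun n : ZSq p => n.toAdd.2) h)))
  · have h3 : z.right ^ p = 1 := by
      have := congrArg rightHom hzp
      rwa [map_pow, map_one] at this
    have h4 : z.right ^ q = 1 := by
      apply Multiplicative.toAdd.injective
      rw [toAdd_pow, toAdd_one]
      ext <;> simp
    have h5 := pow_gcd_eq_one.2 ⟨h3, h4⟩
    rwa [hpq, pow_one] at h5

theorem isEmpty_theta_mulEquiv_psi (hg : orderOf g = q) :
    IsEmpty ((ZSq p ⋊[theta g hg] ZSq q) ≃* (ZSq p ⋊[psi g hg] ZSq q)) := by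
  refine ⟨fun e => ?_⟩
  have h := apply_mem_center e (inr_mem_center_theta hg)
  rw [center_psi, Subgroup.mem_bot, map_eq_one_iff e e.injective,
    map_eq_one_iff _ inr_injective] at h
  exact one_ne_zero (congrArg (fun k : ZSq q => k.toAdd.1) h)

theorem inl_eta_ne_one (hg : orderOf g = q) :
    (inl (Multiplicative.ofAdd (0, 1)) : ZSq p ⋊[eta g hg] ZSq q) ≠ 1 := by
  intro h
  rw [map_eq_one_iff _ inl_injective] at h
  exact one_ne_zero (congrArg (fun k : ZSq p => k.toAdd.2) h)

theorem isEmpty_psi_mulEquiv_eta (hg : orderOf g = q) :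
    IsEmpty ((ZSq p ⋊[psi g hg] ZSq q) ≃* (ZSq p ⋊[eta g hg] ZSq q)) := by
  refine ⟨fun e => ?_⟩
  have h := apply_mem_center e.symm (inl_mem_center_eta hg)
  rw [center_psi, Subgroup.mem_bot, map_eq_one_iff e.symm e.symm.injective] at h
  exact inl_eta_ne_one hg h

/-- Both centres are nontrivial, so `p`-torsion decides: the centre for `eta` contains an element of
order `p`, that for `theta` none. -/
theorem isEmpty_theta_mulEquiv_eta (hg : orderOf g = q) (hpq : Nat.Coprime p q) :
    IsEmpty ((ZSq p ⋊[theta g hg] ZSq q) ≃* (ZSq p ⋊[eta g hg] ZSq q)) := by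
  refine ⟨fun e => ?_⟩
  have h := eq_one_of_mem_center_theta hg hpq (apply_mem_center e.symm (inl_mem_center_eta hg)) (by
    have h1 : (Multiplicative.ofAdd ((0, 1) : ZMod p × ZMod p)) ^ p = 1 := by
      apply Multiplicative.toAdd.injective
      rw [toAdd_pow, toAdd_one]
      ext <;> simp
    rw [← map_pow, ← map_pow, h1, map_one, map_one])
  rw [map_eq_one_iff e.symm e.symm.injective] at h
  exact inl_eta_ne_one hg h

end Actions

end PQGroups

theorem theorem3p14 (p q : ℕ) [Fact p.Prime] [Fact q.Prime] (hqp : q < p) :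
    -- `p ≢ 1 (mod q)`
    (¬ p ≡ 1 [MOD q] →
      ∀ (A : Type*) [SkewLeftBrace A], Nat.card A = p * q →
        Nonempty (SkewLeftBrace.Lambda A ≃* PQGroups.ZSq (p * q))) ∧
    -- `p ≡ 1 (mod q)`, with `g` any element of multiplicative order `q` in `ℤ_p`
    (p ≡ 1 [MOD q] → ∀ (g : (ZMod p)ˣ) (hg : orderOf g = q),
      (∀ (A : Type*) [SkewLeftBrace A], Nat.card A = p * q →
        Nonempty (SkewLeftBrace.Lambda A ≃* PQGroups.ZSq (p * q)) ∨
        Nonempty (SkewLeftBrace.Lambda A ≃*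
          PQGroups.ZSq p ⋊[PQGroups.theta g hg] PQGroups.ZSq q) ∨
        Nonempty (SkewLeftBrace.Lambda A ≃*
          PQGroups.ZSq p ⋊[PQGroups.psi g hg] PQGroups.ZSq q) ∨
        Nonempty (SkewLeftBrace.Lambda A ≃*
          PQGroups.ZSq p ⋊[PQGroups.eta g hg] PQGroups.ZSq q)) ∧
      IsEmpty (PQGroups.ZSq (p * q) ≃* PQGroups.ZSq p ⋊[PQGroups.theta g hg] PQGroups.ZSq q) ∧
      IsEmpty (PQGroups.ZSq (p * q) ≃* PQGroups.ZSq p ⋊[PQGroups.psi g hg] PQGroups.ZSq q) ∧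
      IsEmpty (PQGroups.ZSq (p * q) ≃* PQGroups.ZSq p ⋊[PQGroups.eta g hg] PQGroups.ZSq q) ∧
      IsEmpty ((PQGroups.ZSq p ⋊[PQGroups.theta g hg] PQGroups.ZSq q) ≃*
        (PQGroups.ZSq p ⋊[PQGroups.psi g hg] PQGroups.ZSq q)) ∧
      IsEmpty ((PQGroups.ZSq p ⋊[PQGroups.theta g hg] PQGroups.ZSq q) ≃*
        (PQGroups.ZSq p ⋊[PQGroups.eta g hg] PQGroups.ZSq q)) ∧
      IsEmpty ((PQGroups.ZSq p ⋊[PQGroups.psi g hg] PQGroups.ZSq q) ≃*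
        (PQGroups.ZSq p ⋊[PQGroups.eta g hg] PQGroups.ZSq q))) := by
  have hpq : Nat.Coprime p q := coprime_of_prime_lt hqp
  refine ⟨fun h A _ hA => ?_, fun h g hg => ⟨fun A _ hA => ?_, ?_, ?_, ?_, ?_, ?_, ?_⟩⟩
  · obtain ⟨a, b, s, t, u₁, u₂, v, hgen⟩ := SkewLeftBrace.exists_isGenerating hqp hA
    refine hgen.nonempty_mulEquiv_zsq (SkewLeftBrace.card_lambda hA) hpq ?_
    rw [(Fact.out : q.Prime).coprime_iff_not_dvd]
    exact fun hd => h ((Nat.modEq_iff_dvd' (Fact.out : p.Prime).one_le).2 hd).symm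
  · obtain ⟨a, b, s, t, u₁, u₂, v, hgen⟩ := SkewLeftBrace.exists_isGenerating hqp hA
    exact hgen.nonempty_mulEquiv (SkewLeftBrace.card_lambda hA) hpq g hg
  · exact PQGroups.isEmpty_zsq_mulEquiv (PQGroups.theta_ne_one hg)
  · exact PQGroups.isEmpty_zsq_mulEquiv (PQGroups.psi_ne_one hg)
  · exact PQGroups.isEmpty_zsq_mulEquiv (PQGroups.eta_ne_one hg)
  · exact PQGroups.isEmpty_theta_mulEquiv_psi hg
  · exact PQGroups.isEmpty_theta_mulEquiv_eta hg hpq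
  · exact PQGroups.isEmpty_psi_mulEquiv_eta hg
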